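/- **Setting.** Let $\Omega$ be a compact metric space, $\Sigma$ a $\sigma$-algebra on $\Omega$ containing the Borel sets, and $\mathbb P$ a probability measure on $(\Omega,\Sigma)$. Let $(T_x)_{x\in\mathbb R^3}$ be maps $T_x:\Omega\to\Omega$ with $T_0=\mathrm{Id}$ and $T_{x+y}=T_x\circ T_y$, measurable and measure preserving, such that $(x,\omega)\mapsto T_x\omega$ is continuous, and ergodic: if $A\in\Sigma$ satisfies $T_xA=A$ up to a null set for every $x$, then $\mathbb P(A)\in\{0,1\}$. Fix a typical trajectory $\widetilde\omega\in\Omega$, i.e. $\lim_{t\to\infty}\frac1{t^3|A|}\int_{tA}g(T_x\widetilde\omega)\,dx=\int_\Omega g\,d\mathbb P$ for every bounded Borel set $A\subset\mathbb R^3$ with $|A|>0$ and every $g\in C(\Omega)$. Let $D\subset\mathbb R^3$ be bounded and open. Gradients are transposed Jacobians: the $i$-th row of $\nabla u$ is $\partial_iu$. *Potential fields.* $C^1(\Omega;\mathbb R^3)$ is the set of continuous $v:\Omega\to\mathbb R^3$ for which $D_iv(\omega)=\lim_{\delta\to0}\frac{v(T_{\delta e_i}\omega)-v(\omega)}{\delta}$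 exists for all $\omega\in\Omega$ and $i=1,2,3$, and is continuous in $\omega$; $\nabla_\omega v$ is the matrix with rows $D_1v,D_2v,D_3v$. For a linear subspace $V\subset\mathbb R^3$, $L^2_{\rm pot}(\Omega;V)$ is the closure in $L^2(\Omega;\mathbb R^{3\times3})$ of $\{\nabla_\omega v: v\in C^1(\Omega;\mathbb R^3),\ v(\omega)\in V\text{ for all }\omega\in\Omega\}$. *Weak two-scale convergence.* Let $S\subset(0,\infty)$ be a set with $0\in\overline S$ (for instance $S=(0,\infty)$, or $S=\{\varepsilon_k\}$ with $\varepsilon_k\to0$). A family $(v_\varepsilon)_{\varepsilon\in S}\subset L^2(D;\mathbb R^{3\times3})$ weakly stochastically two-scale converges to $v\in L^2(D\times\Omega;\mathbb R^{3\times3})$ if $\limsup_{\varepsilon\to0}\|v_\varepsilon\|_{L^2(D)}<\infty$ and, for all $\psi\in C_c^\infty(D)$ and $b\in C(\Omega)$, $$\lim_{\varepsilon\to0,\ \varepsilon\in S}\int_D v_\varepsilon(x)\,\psi(x)\,b(T_{x/\varepsilon}\widetilde\omega)\,dx=\int_D\int_\Omega v(x,\omega)\,\psi(x)\,b(\omega)\,d\mathbb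 P(\omega)\,dx .$$ *Manifold.* Let $M\subset\mathbb R^3$ be a $C^2$ orientable (embedded) hypersurface admitting a tubular neighbourhood of uniform thickness: for some $\delta>0$, every $x$ with $\operatorname{dist}(x,M)<\delta$ has a unique nearest point in $M$. Let $H^1(D;M)$ be the set of $u\in H^1(D;\mathbb R^3)$ with $u(x)\in M$ for a.e. $x\in D$. **Proposition.** Let $u_\varepsilon\in H^1(D;M)$ for $\varepsilon\in S$, let $u_0\in H^1(D;\mathbb R^3)$ and $\Xi\in L^2(D;L^2_{\rm pot}(\Omega;\mathbb R^3))$. Suppose that, as $\varepsilon\to0$ in $S$, $$u_\varepsilon\to u_0\ \text{ strongly in }L^2(D;\mathbb R^3),\qquad \nabla u_\varepsilon\ \text{ weakly stochastically two-scale converges to }\ \nabla u_0(x)+\Xi(x,\omega).$$ Then $u_0\in H^1(D;M)$, and $\Xi\in L^2(D;L^2_{\rm pot}(\Omega;T_{u_0(x)}M))$; that is, $\Xi\in L^2(D\times\Omega;\mathbb R^{3\times 3})$ and $\Xi(x,\cdot)\in L^2_{\rm pot}(\Omega;T_{u_0(x)}M)$ for a.e. $x\in D$. -/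

import Mathlib

open MeasureTheory Filter Topology Set
open scoped Pointwise

namespace StochHom

/-- `ℝ³` with its Euclidean norm. -/
abbrev E3 : Type := EuclideanSpace ℝ (Fin 3)

/-- `ℝ^{3×3}` with the Frobenius norm. A matrix is stored through its rows, `A i : ℝ³`; gradients
are transposed Jacobians, so that the `i`-th row of `∇u` is `∂ᵢu`. -/
abbrev Mat3 : Type := PiLp 2 (fun _ : Fin 3 => E3)

/-- The canonical basis of `ℝ³`. -/
noncomputable abbrev basisVec (i : Fin 3) : E3 := EuclideanSpace.single i (1 : ℝ)

section Surface

/-- `γ : U → ℝ` is a `C²` local defining function of the set `M` near its point `s`: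
`U` is an open neighbourhood of `s`, the differential of `γ` does not vanish on `U`, and
`M ∩ U` is the zero set of `γ` in `U`. -/
structure IsLocalDefiningFunction (M : Set E3) (s : E3) (U : Set E3) (γ : E3 → ℝ) : Prop where
  mem_surface : s ∈ M
  isOpen : IsOpen U
  mem : s ∈ U
  contDiffOn : ContDiffOn ℝ 2 γ U
  regular : ∀ x ∈ U, fderiv ℝ γ x ≠ 0
  zeroSet : M ∩ U = {x | x ∈ U ∧ γ x = 0}

/-- `M` is an (embedded) `C²` hypersurface of `ℝ³`. -/
def IsC2Hypersurface (M : Set E3) : Prop :=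
  ∀ s ∈ M, ∃ U γ, IsLocalDefiningFunction M s U γ

/-- The tangent space `T_s M`: the kernel at `s` of the differential of a local defining function
(for a hypersurface all local defining functions at `s` have the same kernel). -/
def tangentSpaceAt (M : Set E3) (s : E3) : Set E3 :=
  {v | ∃ U γ, IsLocalDefiningFunction M s U γ ∧ fderiv ℝ γ s v = 0}

/-- `M` is orientable: it has a continuous unit normal field. -/
def IsOrientableSurface (M : Set E3) : Prop :=
  ∃ ν : E3 → E3, ContinuousOn ν M ∧
    ∀ s ∈ M, ‖ν s‖ = 1 ∧ ∀ v ∈ tangentSpaceAt M s, inner ℝ (ν s) v = 0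

/-- `M` admits a tubular neighbourhood of uniform thickness: for some `δ > 0` the nearest point
projection onto `M` is well defined on the whole neighbourhood `U_δ = {x | dist(x, M) < δ}`.
(For an oriented `C²` hypersurface with unit normal `ν` this says that
`(s, t) ↦ s + t ν(s)` is a bijection from `M × (-δ, δ)` onto `U_δ`, with `M` closed.) -/
def HasUniformTubularNeighborhood (M : Set E3) : Prop :=
  ∃ δ : ℝ, 0 < δ ∧
    ∀ x ∈ Metric.thickening δ M, ∃! s, s ∈ M ∧ dist x s = Metric.infDist x M

end Surface

section Sobolev

/-- `ψ ∈ C_c^∞(D)`. -/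
def IsTestFunction (D : Set E3) (ψ : E3 → ℝ) : Prop :=
  ContDiff ℝ ((⊤ : ℕ∞) : WithTop ℕ∞) ψ ∧ HasCompactSupport ψ ∧ tsupport ψ ⊆ D

/-- `u ∈ H¹(D; ℝ³)` and `G ∈ L²(D; ℝ^{3×3})` is its weak gradient: the row `G x i` is the weak
partial derivative `∂ᵢu`. -/
def HasH1Gradient (D : Set E3) (u : E3 → E3) (G : E3 → Mat3) : Prop :=
  MemLp u 2 (volume.restrict D) ∧ MemLp G 2 (volume.restrict D) ∧
    ∀ ψ : E3 → ℝ, IsTestFunction D ψ → ∀ i : Fin 3,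
      ∫ x in D, (fderiv ℝ ψ x (basisVec i)) • u x = -∫ x in D, ψ x • G x i

/-- `u ∈ H¹(D; M)`: `u ∈ H¹(D; ℝ³)` and `u(x) ∈ M` for a.e. `x ∈ D`. -/
def MemH1Into (D M : Set E3) (u : E3 → E3) : Prop :=
  (∃ G, HasH1Gradient D u G) ∧ ∀ᵐ x ∂(volume.restrict D), u x ∈ M

end Sobolev

section Stochastic

variable {Ω : Type*} [MetricSpace Ω] [MeasurableSpace Ω]

/-- `(T_x)_{x ∈ ℝ³}` is an ergodic, jointly continuous, measure preserving dynamical system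
on `(Ω, P)`. -/
structure IsErgodicDynamicalSystem (P : Measure Ω) (T : E3 → Ω → Ω) : Prop where
  map_zero : T 0 = id
  map_add : ∀ x y, T (x + y) = T x ∘ T y
  measurePreserving : ∀ x, MeasurePreserving (T x) P P
  continuous : Continuous fun p : E3 × Ω => T p.1 p.2
  ergodic : ∀ A : Set Ω, MeasurableSet A → (∀ x, T x '' A =ᵐ[P] A) → P A = 0 ∨ P A = 1

/-- `ω` is a typical trajectory. -/
def IsTypicalTrajectory (P : Measure Ω) (T : E3 → Ω → Ω) (ω : Ω) : Prop :=
  ∀ A : Set E3, Bornology.IsBounded A → MeasurableSet A → 0 < volume A →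
    ∀ g : C(Ω, ℝ),
      Tendsto (fun t : ℝ => (t ^ 3 * (volume A).toReal)⁻¹ * ∫ x in t • A, g (T x ω))
        atTop (𝓝 (∫ ω', g ω' ∂P))

/-- `u ∈ C¹(Ω; ℝ³)` with stochastic gradient `∇_ω u = G`: `u` and `G` are continuous on `Ω`, and
at every `ω` the row `G ω i` is the derivative
`D_i u(ω) = lim_{δ → 0} (u(T_{δ eᵢ} ω) - u(ω)) / δ`. -/
def HasC1Gradient (T : E3 → Ω → Ω) (u : Ω → E3) (G : Ω → Mat3) : Prop :=
  Continuous u ∧ Continuous G ∧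
    ∀ ω, ∀ i : Fin 3,
      Tendsto (fun δ : ℝ => δ⁻¹ • (u (T (δ • basisVec i) ω) - u ω)) (𝓝[≠] 0) (𝓝 (G ω i))

/-- `F ∈ L²_pot(Ω; V)`, for `V ⊆ ℝ³`: the field `F` belongs to the closure in `L²(Ω; ℝ^{3×3})` of
the set of all gradients `∇_ω v` of functions `v ∈ C¹(Ω; ℝ³)` with values in `V`. -/
def MemL2Pot (P : Measure Ω) (T : E3 → Ω → Ω) (V : Set E3) (F : Ω → Mat3) : Prop :=
  MemLp F 2 P ∧
    ∃ (v : ℕ → Ω → E3) (G : ℕ → Ω → Mat3),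
      (∀ n, HasC1Gradient T (v n) (G n) ∧ ∀ ω, v n ω ∈ V) ∧
      Tendsto (fun n => eLpNorm (fun ω => G n ω - F ω) 2 P) atTop (𝓝 0)

/-- `Ξ ∈ L²(D; L²_pot(Ω; V_x))`, for a family of sets `V_x ⊆ ℝ³` indexed by `x ∈ D`. The space
`L²(D; L²(Ω))` is identified with `L²(D × Ω)`. -/
def MemL2L2Pot (D : Set E3) (P : Measure Ω) (T : E3 → Ω → Ω) (V : E3 → Set E3)
    (Ξ : E3 → Ω → Mat3) : Prop :=
  MemLp (fun p : E3 × Ω => Ξ p.1 p.2) 2 ((volume.restrict D).prod P) ∧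
    ∀ᵐ x ∂(volume.restrict D), MemL2Pot P T (V x) (Ξ x)

/-- Weak stochastic two-scale convergence in `L²`, with respect to the trajectory `ω`, of the
family `(v_ε)_{ε ∈ S}` to `v₀ ∈ L²(D × Ω)` as `ε → 0` in `S`. As usual for weak convergence in
`L²`, the family is bounded in `L²(D)` (for small `ε`). -/
def WeakTwoScaleConverges (D : Set E3) (P : Measure Ω) (T : E3 → Ω → Ω) (ω : Ω) (S : Set ℝ)
    (v : ℝ → E3 → Mat3) (v₀ : E3 → Ω → Mat3) : Prop :=
  (∀ ε ∈ S, MemLp (v ε) 2 (volume.restrict D)) ∧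
  MemLp (fun p : E3 × Ω => v₀ p.1 p.2) 2 ((volume.restrict D).prod P) ∧
  (∃ C : ℝ, ∀ᶠ ε in 𝓝[S] (0 : ℝ), eLpNorm (v ε) 2 (volume.restrict D) ≤ ENNReal.ofReal C) ∧
  ∀ ψ : E3 → ℝ, IsTestFunction D ψ → ∀ b : C(Ω, ℝ),
    Tendsto (fun ε : ℝ => ∫ x in D, (ψ x * b (T (ε⁻¹ • x) ω)) • v ε x) (𝓝[S] 0)
      (𝓝 (∫ x in D, ∫ ω', (ψ x * b ω') • v₀ x ω' ∂P))

end Stochastic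

end StochHom

/-!
The surface `M` is closed and a subsequence of `u_ε` converges almost everywhere, so `u₀` takes its
values in `M`.

For the tangency of `Ξ`, let `f` be a compactly supported `C²` function vanishing on `M`, for instance
a local defining function of `M` multiplied by a cut-off. Since `f ∘ u_ε = 0`, the chain rule
`HasH1Gradient.ae_fderiv_eq_zero` (proved by mollification) gives `df(u_ε)(∂ᵢu_ε) = 0` almost
everywhere, and likewise `df(u₀)(∂ᵢu₀) = 0`. The gradient of `f` is Lipschitz, so `∇f(u_ε)` converges
strongly in `L²`, and a weak-strong argument (`WeakTwoScaleConverges.ae_inner_integral_eq_zero`)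
passes to the two-scale limit: for almost every `x` and every continuous `b` on `Ω`,
`∫ b(ω) df(u₀(x))(∂ᵢu₀(x) + Ξ(x, ω)ᵢ) dP(ω) = 0`. The term with `∂ᵢu₀` vanishes, and as
`Ξ(x, ·)` is an `L²` limit of continuous fields, `df(u₀(x))(Ξ(x, ω)ᵢ) = 0` for almost every `ω`
(`MemL2Pot.ae_clm_eq_zero`).

Countably many such `f` suffice to describe all tangent spaces of `M`. So for almost every `x` the rows
of `Ξ(x, ·)` lie in `T_{u₀(x)}M`, and the orthogonal projection onto this plane turns functions in
`C¹(Ω; ℝ³)` whose gradients approximate `Ξ(x, ·)` into tangential ones with the same property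
(`MemL2Pot.of_ae_mem_ker`).
-/

namespace StochHom

open scoped Convolution
open ContinuousLinearMap (lsmul)

/-! ### Mollification of Sobolev maps -/

section Mollification

variable {F : Type*} [NormedAddCommGroup F] [NormedSpace ℝ F]

theorem norm_normed_convolution_le (φ : ContDiffBump (0 : E3)) (g : E3 → F) (x : E3) :
    ‖(φ.normed volume ⋆[lsmul ℝ ℝ, volume] g) x‖ ≤
      (φ.normed volume ⋆[lsmul ℝ ℝ, volume] fun y => ‖g y‖) x := by
  refine (norm_integral_le_integral_norm _).trans (le_of_eq ?_)
  refine integral_congr_ae (Eventually.of_forall fun t => ?_)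
  simp [norm_smul, abs_of_nonneg (φ.nonneg_normed (μ := volume) t)]

theorem integrable_normed (φ : ContDiffBump (0 : E3)) :
    Integrable (φ.normed (volume : Measure E3)) :=
  φ.continuous_normed.integrable_of_hasCompactSupport φ.hasCompactSupport_normed

/-- Mollifications of an integrable function converge to it in `L¹`. Almost everywhere convergence
is Lebesgue's differentiation theorem; the missing mass control is a Scheffé-type argument based on
`‖φ ⋆ g‖ ≤ φ ⋆ ‖g‖` and `∫ φ ⋆ ‖g‖ = ∫ ‖g‖`. -/
theorem tendsto_integral_norm_normed_convolution_sub [CompleteSpace F]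
    {φ : ℕ → ContDiffBump (0 : E3)} {K : ℝ} (hφ : Tendsto (fun n => (φ n).rOut) atTop (𝓝 0))
    (hK : ∀ᶠ n in atTop, (φ n).rOut ≤ K * (φ n).rIn) {g : E3 → F} (hg : Integrable g) :
    Tendsto (fun n => ∫ x, ‖((φ n).normed volume ⋆[lsmul ℝ ℝ, volume] g) x - g x‖) atTop
      (𝓝 0) := by
  set c : ℕ → E3 → F := fun n => (φ n).normed volume ⋆[lsmul ℝ ℝ, volume] g with hc
  set m : ℕ → E3 → ℝ := fun n => (φ n).normed volume ⋆[lsmul ℝ ℝ, volume] fun y => ‖g y‖ with hm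
  have hcint : ∀ n, Integrable (c n) := fun n =>
    (integrable_normed (φ n)).integrable_convolution _ hg
  have hmint : ∀ n, Integrable (m n) := fun n =>
    (integrable_normed (φ n)).integrable_convolution _ hg.norm
  have hmI : ∀ n, ∫ x, m n x = ∫ x, ‖g x‖ := fun n => by
    rw [hm]
    simp only
    rw [integral_convolution (lsmul ℝ ℝ) (integrable_normed (φ n)) hg.norm,
      (φ n).integral_normed]
    simp
  have hcae := ContDiffBump.ae_convolution_tendsto_right_of_locallyIntegrable (μ := volume) hφ hK
    hg.locallyIntegrable
  have hmae := ContDiffBump.ae_convolution_tendsto_right_of_locallyIntegrable (μ := volume) hφ hK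
    hg.norm.locallyIntegrable
  have h1 : Tendsto (fun n => ∫ x, min ‖c n x - g x‖ (2 * ‖g x‖)) atTop
      (𝓝 (∫ _ : E3, (0 : ℝ))) := by
    refine tendsto_integral_of_dominated_convergence (fun x => 2 * ‖g x‖) (fun n => ?_)
      (hg.norm.const_mul 2) (fun n => Eventually.of_forall fun x => ?_) ?_
    · exact (((hcint n).sub hg).norm.inf (hg.norm.const_mul 2)).aestronglyMeasurable
    · rw [Real.norm_of_nonneg (le_min (norm_nonneg _) (by positivity))]
      exact min_le_right _ _
    · filter_upwards [hcae] with x hx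
      have := ((hx.sub_const (g x)).norm).min (tendsto_const_nhds (x := 2 * ‖g x‖))
      simpa using this
  have h2 : Tendsto (fun n => ∫ x, max (‖g x‖ - m n x) 0) atTop (𝓝 (∫ _ : E3, (0 : ℝ))) := by
    refine tendsto_integral_of_dominated_convergence (fun x => ‖g x‖) (fun n => ?_)
      hg.norm (fun n => Eventually.of_forall fun x => ?_) ?_
    · exact (hg.norm.sub (hmint n)).pos_part.aestronglyMeasurable
    · have : 0 ≤ m n x := (norm_nonneg _).trans (norm_normed_convolution_le (φ n) g x)
      rw [Real.norm_of_nonneg (le_max_right _ _)]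
      exact max_le (by linarith) (norm_nonneg _)
    · filter_upwards [hmae] with x hx
      have := (hx.const_sub ‖g x‖).max (tendsto_const_nhds (x := (0 : ℝ)))
      simpa using this
  -- With `d = ‖c n - g‖ ≤ m n + ‖g‖` and `|t| = t + 2 max (-t) 0` for `t = m n - ‖g‖`, one has
  -- `d ≤ min d (2 ‖g‖) + |t|`, where `t` has zero integral.
  have h3 := h1.add (h2.const_mul 2)
  simp only [integral_zero, mul_zero, add_zero] at h3
  refine squeeze_zero (fun n => integral_nonneg fun x => norm_nonneg _) (fun n => ?_) h3
  have hi1 : Integrable (fun x => min ‖c n x - g x‖ (2 * ‖g x‖)) :=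
    ((hcint n).sub hg).norm.inf (hg.norm.const_mul 2)
  have hi2 : Integrable (fun x => 2 * max (‖g x‖ - m n x) 0) :=
    (hg.norm.sub (hmint n)).pos_part.const_mul 2
  have hi3 : Integrable (fun x => m n x - ‖g x‖) := (hmint n).sub hg.norm
  have hz : ∫ x, (m n x - ‖g x‖) = 0 := by
    rw [integral_sub (hmint n) hg.norm, hmI, sub_self]
  calc ∫ x, ‖c n x - g x‖
      ≤ ∫ x, (min ‖c n x - g x‖ (2 * ‖g x‖) + 2 * max (‖g x‖ - m n x) 0 + (m n x - ‖g x‖)) := by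
        refine integral_mono ((hcint n).sub hg).norm ((hi1.add hi2).add hi3) fun x => ?_
        have ha : ‖c n x - g x‖ ≤ m n x + ‖g x‖ :=
          (norm_sub_le _ _).trans (by gcongr; exact norm_normed_convolution_le (φ n) g x)
        have hb := le_max_left (‖g x‖ - m n x) 0
        have hb' := le_max_right (‖g x‖ - m n x) 0
        simp only
        rcases min_cases ‖c n x - g x‖ (2 * ‖g x‖) with ⟨h, _⟩ | ⟨h, _⟩ <;> rw [h] <;> linarith
    _ = _ := by
        have hi12 : Integrable fun x =>
            min ‖c n x - g x‖ (2 * ‖g x‖) + 2 * max (‖g x‖ - m n x) 0 := hi1.add hi2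
        rw [integral_add hi12 hi3, integral_add hi1 hi2, hz, add_zero, integral_const_mul]

end Mollification

theorem HasH1Gradient.integrableOn {D : Set E3} (hDb : Bornology.IsBounded D) {u : E3 → E3}
    {G : E3 → Mat3} (h : HasH1Gradient D u G) :
    IntegrableOn u D ∧ ∀ i, IntegrableOn (fun x => G x i) D := by
  have : IsFiniteMeasure (volume.restrict D) := ⟨by
    simpa using hDb.measure_lt_top⟩
  refine ⟨h.1.integrable (by norm_num), fun i => ?_⟩
  exact (PiLp.proj (𝕜 := ℝ) 2 (fun _ : Fin 3 => E3) i).integrable_comp (h.2.1.integrable (by norm_num))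

/-- At points of `D` further from the complement than the radius of the mollifier, the mollified map
(extended by zero outside `D`) has the mollified weak gradient as its classical gradient. -/
theorem fderiv_normed_convolution_indicator {D : Set E3} (hD : IsOpen D)
    (hDb : Bornology.IsBounded D) {u : E3 → E3} {G : E3 → Mat3} (h : HasH1Gradient D u G)
    (φ : ContDiffBump (0 : E3)) {x : E3} (hx : Metric.closedBall x φ.rOut ⊆ D) (i : Fin 3) :
    fderiv ℝ (φ.normed volume ⋆[lsmul ℝ ℝ, volume] D.indicator u) x (basisVec i) =
      (φ.normed volume ⋆[lsmul ℝ ℝ, volume] D.indicator fun y => G y i) x := by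
  obtain ⟨hu, -⟩ := h.integrableOn hDb
  have hU : LocallyIntegrable (D.indicator u) :=
    ((integrable_indicator_iff hD.measurableSet).2 hu).locallyIntegrable
  have hcd : ContDiff ℝ ((⊤ : ℕ∞) : WithTop ℕ∞) (φ.normed (volume : Measure E3)) :=
    φ.contDiff_normed
  have hc1 : ContDiff ℝ 1 (φ.normed (volume : Measure E3)) := hcd.of_le (by norm_cast)
  rw [(φ.hasCompactSupport_normed.hasFDerivAt_convolution_left (lsmul ℝ ℝ) hc1 hU x).fderiv]
  -- the kernel `y ↦ φ (x - y)` is itself a test function on `D`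
  set ψ : E3 → ℝ := fun y => φ.normed volume (x - y) with hψ
  have hsub : tsupport ψ ⊆ Metric.closedBall x φ.rOut := by
    refine closure_minimal (fun y hy => ?_) Metric.isClosed_closedBall
    have : x - y ∈ Function.support (φ.normed (volume : Measure E3)) := hy
    rw [φ.support_normed_eq] at this
    rw [Metric.mem_closedBall, dist_comm, dist_eq_norm]
    simpa using (Metric.mem_ball.1 this).le
  have hψt : IsTestFunction D ψ :=
    ⟨hcd.comp (contDiff_const.sub contDiff_id),
      (isCompact_closedBall x φ.rOut).of_isClosed_subset (isClosed_tsupport _) hsub,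
      hsub.trans hx⟩
  have hder : ∀ y, fderiv ℝ ψ y (basisVec i) =
      -fderiv ℝ (φ.normed (volume : Measure E3)) (x - y) (basisVec i) := fun y => by
    have h1 := (hc1.differentiable one_ne_zero (x - y)).hasFDerivAt.comp y
      ((hasFDerivAt_const x y).sub (hasFDerivAt_id y))
    have h2 : HasFDerivAt ψ _ y := h1
    rw [h2.fderiv]
    simp
  have hw := h.2.2 ψ hψt i
  have hR : (φ.normed volume ⋆[lsmul ℝ ℝ, volume] D.indicator fun y => G y i) x =
      ∫ y in D, ψ y • G y i := by
    rw [convolution_eq_swap, ← integral_indicator hD.measurableSet]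
    refine integral_congr_ae (Eventually.of_forall fun y => ?_)
    by_cases hy : y ∈ D <;> simp [hy, hψ]
  have hce := (φ.hasCompactSupport_normed.fderiv (𝕜 := ℝ)).convolutionExists_left
    ((lsmul ℝ ℝ).precompL E3 : (E3 →L[ℝ] ℝ) →L[ℝ] E3 →L[ℝ] E3 →L[ℝ] E3)
    (hc1.continuous_fderiv one_ne_zero) hU x
  rw [hR, convolution_eq_swap, ContinuousLinearMap.integral_apply]
  · have : ∀ y, (((lsmul ℝ ℝ).precompL E3 : (E3 →L[ℝ] ℝ) →L[ℝ] E3 →L[ℝ] E3 →L[ℝ] E3)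
        (fderiv ℝ (φ.normed (volume : Measure E3)) (x - y)) (D.indicator u y)) (basisVec i) =
        D.indicator (fun y => -(fderiv ℝ ψ y (basisVec i) • u y)) y := fun y => by
      rw [ContinuousLinearMap.precompL_apply]
      by_cases hy : y ∈ D <;> simp [hy, hder]
    simp_rw [this]
    rw [integral_indicator hD.measurableSet, integral_neg, hw, neg_neg]
  · exact hce.integrable_swap

/-! ### A chain rule for maps with values in a level set -/

theorem exists_contDiffBump_seq : ∃ φ : ℕ → ContDiffBump (0 : E3),
    Tendsto (fun n => (φ n).rOut) atTop (𝓝 0) ∧ ∀ n, (φ n).rOut ≤ 2 * (φ n).rIn := by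
  refine ⟨fun n => ⟨1 / (2 * ((n : ℝ) + 1)), 1 / ((n : ℝ) + 1), by positivity, ?_⟩, ?_, fun n => ?_⟩
  · apply one_div_lt_one_div_of_lt <;> linarith [n.cast_nonneg (α := ℝ)]
  · exact tendsto_one_div_add_atTop_nhds_zero_nat
  · refine le_of_eq ?_
    have : (n : ℝ) + 1 ≠ 0 := by positivity
    field_simp

theorem aestronglyMeasurable_fderiv_apply {μ : Measure E3} {f : E3 → ℝ}
    (hf : Continuous (fderiv ℝ f)) {v w : E3 → E3} (hv : AEStronglyMeasurable v μ)
    (hw : AEStronglyMeasurable w μ) :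
    AEStronglyMeasurable (fun x => fderiv ℝ f (v x) (w x)) μ :=
  (isBoundedBilinearMap_apply (𝕜 := ℝ) (E := E3) (F := ℝ)).continuous.comp_aestronglyMeasurable
    ((hf.comp_aestronglyMeasurable hv).prodMk hw)

/-- If a Sobolev map `u` takes its values in the zero set of the compactly supported `C¹` function
`f`, then its partial derivatives are annihilated by the differential of `f`. For the mollified maps
`uₙ`, `∫ ψ df(uₙ)(∂ᵢuₙ) = -∫ ∂ᵢψ f(uₙ)`; in the limit the left side becomes `∫ ψ df(u)(∂ᵢu)` and
the right side vanishes. -/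
theorem HasH1Gradient.ae_fderiv_eq_zero {D : Set E3} (hD : IsOpen D)
    (hDb : Bornology.IsBounded D) {u : E3 → E3} {G : E3 → Mat3} (h : HasH1Gradient D u G)
    {f : E3 → ℝ} (hf : ContDiff ℝ 1 f) (hfc : HasCompactSupport f)
    (hfu : ∀ᵐ x ∂volume.restrict D, f (u x) = 0) :
    ∀ᵐ x ∂volume.restrict D, ∀ i, fderiv ℝ f (u x) (G x i) = 0 := by
  rw [ae_all_iff]
  intro i
  obtain ⟨hu, hG⟩ := h.integrableOn hDb
  obtain ⟨φ, hφ, hK⟩ := exists_contDiffBump_seq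
  set U : E3 → E3 := D.indicator u with hU
  set g : E3 → E3 := D.indicator fun y => G y i with hg
  have hUi : Integrable U := (integrable_indicator_iff hD.measurableSet).2 hu
  have hgi : Integrable g := (integrable_indicator_iff hD.measurableSet).2 (hG i)
  set w : ℕ → E3 → E3 := fun n => (φ n).normed volume ⋆[lsmul ℝ ℝ, volume] U with hw
  set c : ℕ → E3 → E3 := fun n => (φ n).normed volume ⋆[lsmul ℝ ℝ, volume] g with hc
  have hwsm : ∀ n, ContDiff ℝ 1 (w n) := fun n =>
    (φ n).hasCompactSupport_normed.contDiff_convolution_left (n := 1) _ (φ n).contDiff_normed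
      hUi.locallyIntegrable
  have hcsm : ∀ n, Continuous (c n) := fun n =>
    ((φ n).hasCompactSupport_normed.contDiff_convolution_left (n := 0) _ (φ n).contDiff_normed
      hgi.locallyIntegrable).continuous
  have hwae : ∀ᵐ x, Tendsto (fun n => w n x) atTop (𝓝 (U x)) :=
    ContDiffBump.ae_convolution_tendsto_right_of_locallyIntegrable hφ
      (Eventually.of_forall hK) hUi.locallyIntegrable
  have hcL1 := tendsto_integral_norm_normed_convolution_sub hφ (Eventually.of_forall hK) hgi
  have hdf : Continuous (fderiv ℝ f) := hf.continuous_fderiv one_ne_zero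
  obtain ⟨B, hB⟩ := (hfc.fderiv (𝕜 := ℝ)).exists_bound_of_continuous hdf
  obtain ⟨A, hA⟩ := hfc.exists_bound_of_continuous hf.continuous
  have hmeasG : AEStronglyMeasurable (fun x => fderiv ℝ f (U x) (g x)) volume :=
    aestronglyMeasurable_fderiv_apply hdf hUi.aestronglyMeasurable hgi.aestronglyMeasurable
  have hintG : Integrable (fun x => fderiv ℝ f (U x) (g x)) := by
    refine (hgi.norm.const_mul B).mono' hmeasG (Eventually.of_forall fun x => ?_)
    exact (ContinuousLinearMap.le_opNorm _ _).trans (by gcongr; exact hB _)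
  have key : ∀ ψ : E3 → ℝ, IsTestFunction D ψ → ∫ x, ψ x * fderiv ℝ f (U x) (g x) = 0 := by
    intro ψ ⟨hψs, hψc, hψD⟩
    have hψ1 : ContDiff ℝ 1 ψ := hψs.of_le (by norm_cast)
    obtain ⟨C, hC⟩ := hψc.exists_bound_of_continuous hψs.continuous
    obtain ⟨ρ, hρ, hρD⟩ := (hψc : IsCompact (tsupport ψ)).exists_cthickening_subset_open hD hψD
    have hdψ : Continuous fun x => fderiv ℝ ψ x (basisVec i) :=
      (hψ1.continuous_fderiv one_ne_zero).clm_apply continuous_const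
    have hdψc : HasCompactSupport fun x => fderiv ℝ ψ x (basisVec i) :=
      hψc.fderiv_apply (𝕜 := ℝ) _
    have hdψi : Integrable fun x => fderiv ℝ ψ x (basisVec i) :=
      hdψ.integrable_of_hasCompactSupport hdψc
    -- classical integration by parts for the mollified maps
    have hibp : ∀ᶠ n in atTop, ∫ x, ψ x * fderiv ℝ f (w n x) (c n x) =
        -∫ x, fderiv ℝ ψ x (basisVec i) * f (w n x) := by
      filter_upwards [hφ.eventually (gt_mem_nhds hρ)] with n hn
      have hcomp : ContDiff ℝ 1 fun x => f (w n x) := hf.comp (hwsm n)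
      have hEq : ∀ x, ψ x * fderiv ℝ f (w n x) (c n x) =
          ψ x * fderiv ℝ (fun x => f (w n x)) x (basisVec i) := by
        intro x
        by_cases hx : x ∈ tsupport ψ
        · have hb : Metric.closedBall x (φ n).rOut ⊆ D :=
            (Metric.closedBall_subset_closedBall hn.le).trans
              ((Metric.closedBall_subset_cthickening hx ρ).trans hρD)
          have hch : fderiv ℝ (fun x => f (w n x)) x =
              (fderiv ℝ f (w n x)).comp (fderiv ℝ (w n) x) :=
            fderiv_comp x (hf.differentiable one_ne_zero _)
              ((hwsm n).differentiable one_ne_zero _)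
          rw [hch, ContinuousLinearMap.comp_apply,
            fderiv_normed_convolution_indicator hD hDb h (φ n) hb i]
        · simp [image_eq_zero_of_notMem_tsupport hx]
      simp_rw [hEq]
      refine integral_mul_fderiv_eq_neg_fderiv_mul_of_integrable ?_ ?_ ?_
        (fun x _ => hψ1.differentiable one_ne_zero x)
        (fun x _ => hcomp.differentiable one_ne_zero x)
      · exact (hdψ.mul hcomp.continuous).integrable_of_hasCompactSupport hdψc.mul_right
      · exact (hψs.continuous.mul ((hcomp.continuous_fderiv one_ne_zero).clm_apply
          continuous_const)).integrable_of_hasCompactSupport hψc.mul_right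
      · exact (hψs.continuous.mul hcomp.continuous).integrable_of_hasCompactSupport
          hψc.mul_right
    have hR : Tendsto (fun n => ∫ x, fderiv ℝ ψ x (basisVec i) * f (w n x)) atTop
        (𝓝 (∫ x, fderiv ℝ ψ x (basisVec i) * f (U x))) := by
      refine tendsto_integral_of_dominated_convergence
        (fun x => ‖fderiv ℝ ψ x (basisVec i)‖ * A) (fun n => ?_) (hdψi.norm.mul_const A)
        (fun n => Eventually.of_forall fun x => ?_) ?_
      · exact (hdψ.mul (hf.continuous.comp (hwsm n).continuous)).aestronglyMeasurable
      · rw [norm_mul]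
        gcongr
        exact hA _
      · filter_upwards [hwae] with x hx
        exact ((hf.continuous.tendsto _).comp hx).const_mul _
    have hR0 : ∫ x, fderiv ℝ ψ x (basisVec i) * f (U x) = 0 := by
      refine integral_eq_zero_of_ae ?_
      filter_upwards [(ae_restrict_iff' hD.measurableSet).1 hfu] with x hx
      by_cases hxD : x ∈ D
      · simp [hU, hxD, hx hxD]
      · have : fderiv ℝ ψ x = 0 :=
          image_eq_zero_of_notMem_tsupport fun hx' => hxD (hψD (tsupport_fderiv_subset ℝ hx'))
        simp [this]
    have hL1 : Tendsto (fun n => ∫ x, ψ x * fderiv ℝ f (w n x) (g x)) atTop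
        (𝓝 (∫ x, ψ x * fderiv ℝ f (U x) (g x))) := by
      refine tendsto_integral_of_dominated_convergence
        (fun x => C * (B * ‖g x‖)) (fun n => ?_) ((hgi.norm.const_mul B).const_mul C)
        (fun n => Eventually.of_forall fun x => ?_) ?_
      · exact hψs.continuous.aestronglyMeasurable.mul
          (aestronglyMeasurable_fderiv_apply hdf (hwsm n).continuous.aestronglyMeasurable
            hgi.aestronglyMeasurable)
      · rw [norm_mul]
        exact mul_le_mul (hC x) ((ContinuousLinearMap.le_opNorm _ _).trans
          (by gcongr; exact hB _)) (norm_nonneg _) ((norm_nonneg _).trans (hC x))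
      · filter_upwards [hwae] with x hx
        have h1 : Tendsto (fun n => fderiv ℝ f (w n x)) atTop (𝓝 (fderiv ℝ f (U x))) :=
          (hdf.tendsto _).comp hx
        exact (((ContinuousLinearMap.apply ℝ ℝ (g x)).continuous.tendsto _).comp h1).const_mul _
    have hB0 : 0 ≤ B := (norm_nonneg _).trans (hB 0)
    have hC0 : 0 ≤ C := (norm_nonneg _).trans (hC 0)
    have hci : ∀ n, Integrable (c n) := fun n =>
      (integrable_normed (φ n)).integrable_convolution _ hgi
    have hbd : ∀ n (v : E3 → E3), ∀ x,
        ‖ψ x * fderiv ℝ f (w n x) (v x)‖ ≤ C * B * ‖v x‖ := fun n v x => by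
      rw [norm_mul, mul_assoc]
      exact mul_le_mul (hC x) ((ContinuousLinearMap.le_opNorm _ _).trans
        (by gcongr; exact hB _)) (norm_nonneg _) hC0
    have hii : ∀ n (v : E3 → E3), Integrable v →
        Integrable fun x => ψ x * fderiv ℝ f (w n x) (v x) := fun n v hv =>
      (hv.norm.const_mul (C * B)).mono' (hψs.continuous.aestronglyMeasurable.mul
          (aestronglyMeasurable_fderiv_apply hdf (hwsm n).continuous.aestronglyMeasurable
            hv.aestronglyMeasurable)) (Eventually.of_forall (hbd n v))
    have hL2 : Tendsto (fun n => ∫ x, ψ x * fderiv ℝ f (w n x) (c n x - g x)) atTop (𝓝 0) := by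
      have h3 := hcL1.const_mul (C * B)
      rw [mul_zero] at h3
      refine squeeze_zero_norm (fun n => ?_) h3
      rw [← integral_const_mul]
      exact norm_integral_le_of_norm_le (((hci n).sub hgi).norm.const_mul _)
        (Eventually.of_forall (hbd n fun x => c n x - g x))
    have hL : Tendsto (fun n => ∫ x, ψ x * fderiv ℝ f (w n x) (c n x)) atTop
        (𝓝 (∫ x, ψ x * fderiv ℝ f (U x) (g x))) := by
      have := hL2.add hL1
      rw [zero_add] at this
      refine this.congr fun n => ?_
      rw [← integral_add (hii n (fun x => c n x - g x) ((hci n).sub hgi)) (hii n g hgi)]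
      refine integral_congr_ae (Eventually.of_forall fun x => ?_)
      simp only [map_sub]
      ring
    rw [hR0] at hR
    simpa using tendsto_nhds_unique hL (hR.neg.congr' (hibp.mono fun n hn => hn.symm))
  have := hD.ae_eq_zero_of_integral_contDiff_smul_eq_zero (μ := volume)
    (hintG.locallyIntegrable.locallyIntegrableOn D) fun ψ h1 h2 h3 => key ψ ⟨h1, h2, h3⟩
  rw [ae_restrict_iff' hD.measurableSet]
  filter_upwards [this] with x hx hxD
  simpa [hU, hg, hxD] using hx hxD

/-! ### Products of weakly and strongly convergent sequences -/

section WeakStrong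

variable {H : Type*} [NormedAddCommGroup H] [InnerProductSpace ℝ H] [CompleteSpace H]

/-- In a Hilbert space, let `F n` be eventually bounded and converge to `F₀` when tested against a set
`A` with trivial orthogonal complement. Then `⟪g n, F n⟫ → ⟪g₀, F₀⟫` whenever `g n → g₀` in norm. -/
theorem tendsto_inner_of_total {F : ℕ → H} {F₀ : H} {C : ℝ} (hb : ∀ᶠ n in atTop, ‖F n‖ ≤ C)
    {A : Set H} (hA : ∀ h, (∀ a ∈ A, inner ℝ a h = 0) → h = 0)
    (hF : ∀ a ∈ A, Tendsto (fun n => inner ℝ a (F n)) atTop (𝓝 (inner ℝ a F₀)))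
    {g : ℕ → H} {g₀ : H} (hg : Tendsto g atTop (𝓝 g₀)) :
    Tendsto (fun n => inner ℝ (g n) (F n)) atTop (𝓝 (inner ℝ g₀ F₀)) := by
  have hspan : ∀ h ∈ Submodule.span ℝ A,
      Tendsto (fun n => inner ℝ h (F n)) atTop (𝓝 (inner ℝ h F₀)) := by
    intro h hh
    induction hh using Submodule.span_induction with
    | mem x hx => exact hF x hx
    | zero => simp
    | add x y _ _ hx hy => simpa only [inner_add_left] using hx.add hy
    | smul c x _ hx => simpa only [real_inner_smul_left] using hx.const_mul c
  have htop : (Submodule.span ℝ A).topologicalClosure = ⊤ := by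
    rw [Submodule.topologicalClosure_eq_top_iff, Submodule.eq_bot_iff]
    exact fun h hh => hA h fun a ha => hh a (Submodule.subset_span ha)
  have hall : ∀ h, Tendsto (fun n => inner ℝ h (F n)) atTop (𝓝 (inner ℝ h F₀)) := by
    intro h
    have hcl : h ∈ closure (Submodule.span ℝ A : Set H) := by
      rw [← Submodule.topologicalClosure_coe, htop]; trivial
    rw [Metric.tendsto_atTop']
    intro ε hε
    have hC' : 0 < |C| + ‖F₀‖ + 1 := by positivity
    obtain ⟨k, hk, hhk⟩ := Metric.mem_closure_iff.1 hcl (ε / 2 / (|C| + ‖F₀‖ + 1)) (by positivity)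
    have hev := (Metric.tendsto_nhds.1 (hspan k hk) (ε / 2) (by positivity)).and hb
    obtain ⟨N, hN⟩ := eventually_atTop.1 hev
    refine ⟨N, fun n hn => ?_⟩
    obtain ⟨h1, h2⟩ := hN n hn.le
    rw [Real.dist_eq] at h1 ⊢
    rw [dist_eq_norm, lt_div_iff₀ hC'] at hhk
    have e : inner ℝ h (F n) - inner ℝ h F₀ = inner ℝ (h - k) (F n - F₀) +
        (inner ℝ k (F n) - inner ℝ k F₀) := by
      simp only [inner_sub_left, inner_sub_right]; ring
    have h3 : |inner ℝ (h - k) (F n - F₀)| ≤ ‖h - k‖ * (|C| + ‖F₀‖ + 1) := by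
      refine (abs_real_inner_le_norm _ _).trans ?_
      gcongr
      linarith [norm_sub_le (F n) F₀, le_abs_self C]
    rw [e]
    linarith [abs_add_le (inner ℝ (h - k) (F n - F₀)) (inner ℝ k (F n) - inner ℝ k F₀)]
  have hdiff : Tendsto (fun n => inner ℝ (g n - g₀) (F n)) atTop (𝓝 0) := by
    have h0 : Tendsto (fun n => ‖g n - g₀‖ * C) atTop (𝓝 0) := by
      simpa using (tendsto_iff_norm_sub_tendsto_zero.1 hg).mul_const C
    refine squeeze_zero_norm' (hb.mono fun n hn => ?_) h0
    exact (abs_real_inner_le_norm _ _).trans (by gcongr)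
  simpa [inner_sub_left] using hdiff.add (hall g₀)

end WeakStrong

theorem IsTestFunction.exists_bound {D : Set E3} {ψ : E3 → ℝ} (hψ : IsTestFunction D ψ) :
    ∃ C, 0 ≤ C ∧ ∀ x, ‖ψ x‖ ≤ C := by
  obtain ⟨C, hC⟩ := hψ.2.1.exists_bound_of_continuous hψ.1.continuous
  exact ⟨C, (norm_nonneg _).trans (hC 0), hC⟩

theorem memLp_smul_of_bound {μ : Measure E3} {F : Type*} [NormedAddCommGroup F] [NormedSpace ℝ F]
    {a : E3 → ℝ} (ha : Continuous a) {C : ℝ} (hC : ∀ x, ‖a x‖ ≤ C) {f : E3 → F}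
    (hf : MemLp f 2 μ) : MemLp (fun x => a x • f x) 2 μ :=
  hf.of_le_mul (c := C) (ha.aestronglyMeasurable.smul hf.1) (Eventually.of_forall fun x => by
    rw [norm_smul]; gcongr; exact hC x)

theorem tendsto_eLpNorm_zero_of_le_mul {α F F' : Type*} [MeasurableSpace α] {μ : Measure α}
    [NormedAddCommGroup F] [NormedAddCommGroup F'] {a : ℕ → α → F} {c : ℕ → α → F'} {B : ℝ}
    (hac : ∀ n x, ‖a n x‖ ≤ B * ‖c n x‖)
    (hc : Tendsto (fun n => eLpNorm (c n) 2 μ) atTop (𝓝 0)) :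
    Tendsto (fun n => eLpNorm (a n) 2 μ) atTop (𝓝 0) := by
  have h0 : Tendsto (fun n => ENNReal.ofReal B * eLpNorm (c n) 2 μ) atTop (𝓝 0) := by
    simpa using ENNReal.Tendsto.const_mul hc (Or.inr ENNReal.ofReal_ne_top)
  exact tendsto_of_tendsto_of_tendsto_of_le_of_le tendsto_const_nhds h0 (fun n => zero_le)
    fun n => eLpNorm_le_mul_eLpNorm_of_ae_le_mul (Eventually.of_forall (hac n)) 2

/-- Pointwise orthogonality passes to the limit between a strongly `L²`-convergent sequence `p n` and
a bounded sequence `f n` converging in the sense of distributions to `f₀ ∈ L²`. -/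
theorem ae_inner_eq_zero_of_weak_strong {D : Set E3} (hD : IsOpen D)
    (hDb : Bornology.IsBounded D) {f : ℕ → E3 → E3} {f₀ : E3 → E3} {p : ℕ → E3 → E3} {p₀ : E3 → E3}
    (hf : ∀ n, MemLp (f n) 2 (volume.restrict D)) (hf₀ : MemLp f₀ 2 (volume.restrict D))
    (hp : ∀ n, MemLp (p n) 2 (volume.restrict D)) (hp₀ : MemLp p₀ 2 (volume.restrict D))
    {C : ℝ} (hC : ∀ᶠ n in atTop, eLpNorm (f n) 2 (volume.restrict D) ≤ ENNReal.ofReal C)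
    (hweak : ∀ ψ, IsTestFunction D ψ →
      Tendsto (fun n => ∫ x in D, ψ x • f n x) atTop (𝓝 (∫ x in D, ψ x • f₀ x)))
    (hstrong : Tendsto (fun n => eLpNorm (fun x => p n x - p₀ x) 2 (volume.restrict D)) atTop
      (𝓝 0))
    (horth : ∀ n, ∀ᵐ x ∂volume.restrict D, inner ℝ (p n x) (f n x) = 0) :
    ∀ᵐ x ∂volume.restrict D, inner ℝ (p₀ x) (f₀ x) = 0 := by
  have hfin : IsFiniteMeasure (volume.restrict D) := ⟨by simpa using hDb.measure_lt_top⟩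
  have hint : Integrable (fun x => (inner ℝ (p₀ x) (f₀ x) : ℝ)) (volume.restrict D) := by
    refine (L2.integrable_inner (𝕜 := ℝ) (hp₀.toLp p₀) (hf₀.toLp f₀)).congr ?_
    filter_upwards [hp₀.coeFn_toLp, hf₀.coeFn_toLp] with x h1 h2
    rw [h1, h2]
  have hmem : ∀ {ψ : E3 → ℝ}, IsTestFunction D ψ → ∀ {q : E3 → E3},
      MemLp q 2 (volume.restrict D) → MemLp (fun x => ψ x • q x) 2 (volume.restrict D) := by
    intro ψ hψ q hq
    obtain ⟨B, -, hB⟩ := hψ.exists_bound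
    exact memLp_smul_of_bound hψ.1.continuous hB hq
  have hinner : ∀ {q r : E3 → E3} (hq : MemLp q 2 (volume.restrict D))
      (hr : MemLp r 2 (volume.restrict D)),
      (inner ℝ (hq.toLp q) (hr.toLp r) : ℝ) = ∫ x in D, inner ℝ (q x) (r x) := by
    intro q r hq hr
    rw [L2.inner_def]
    refine integral_congr_ae ?_
    filter_upwards [hq.coeFn_toLp, hr.coeFn_toLp] with x h1 h2
    rw [h1, h2]
  have hvol : ∀ {q : E3 → E3} {ψ : E3 → ℝ}, IsTestFunction D ψ → ∀ e : E3,
      MemLp q 2 (volume.restrict D) →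
      ∫ x in D, (inner ℝ (ψ x • e) (q x) : ℝ) = inner ℝ e (∫ x in D, ψ x • q x) := by
    intro q ψ hψ e hq
    rw [← integral_inner ((hmem hψ hq).integrable (by norm_num))]
    simp_rw [real_inner_smul_left, real_inner_smul_right]
  have key : ∀ ψ : E3 → ℝ, IsTestFunction D ψ →
      ∫ x in D, ψ x • (inner ℝ (p₀ x) (f₀ x) : ℝ) = 0 := by
    intro ψ hψ
    obtain ⟨B, hB0, hB⟩ := hψ.exists_bound
    -- The fields `η e` with `η` a test function and `e ∈ ℝ³` are total in `L²(D; ℝ³)`.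
    set A : Set (Lp E3 2 (volume.restrict D)) :=
      {a | ∃ (η : E3 → ℝ) (hη : IsTestFunction D η) (e : E3),
        a = (hmem hη (memLp_const e)).toLp (fun x => η x • e)} with hA
    have hlim := tendsto_inner_of_total (F := fun n => (hf n).toLp (f n)) (F₀ := hf₀.toLp f₀)
      (C := max C 0) (A := A) (g := fun n => (hmem hψ (hp n)).toLp _)
      (g₀ := (hmem hψ hp₀).toLp _) ?_ ?_ ?_ ?_
    · have hz : ∀ n, (inner ℝ ((hmem hψ (hp n)).toLp _) ((hf n).toLp (f n)) : ℝ) = 0 := by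
        intro n
        rw [hinner]
        refine integral_eq_zero_of_ae ?_
        filter_upwards [horth n] with x hx
        simp [real_inner_smul_left, hx]
      simp_rw [hz] at hlim
      have := tendsto_nhds_unique hlim tendsto_const_nhds
      rw [hinner] at this
      simpa [real_inner_smul_left] using this
    · filter_upwards [hC] with n hn
      rw [Lp.norm_toLp]
      exact (ENNReal.toReal_mono ENNReal.ofReal_ne_top hn).trans (ENNReal.toReal_ofReal_eq_iff.2
        (le_max_right C 0) ▸ ENNReal.toReal_mono ENNReal.ofReal_ne_top
          (ENNReal.ofReal_le_ofReal (le_max_left C 0)))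
    · intro h hh
      have hhL := Lp.memLp h
      have := hD.ae_eq_zero_of_integral_contDiff_smul_eq_zero (μ := volume) (f := h)
        (IntegrableOn.locallyIntegrableOn (hhL.integrable (by norm_num))) fun η h1 h2 h3 => by
          have hη : IsTestFunction D η := ⟨h1, h2, h3⟩
          have hout : ∀ x, x ∉ D → η x • h x = 0 := fun x hx => by
            rw [image_eq_zero_of_notMem_tsupport fun hx' => hx (h3 hx'), zero_smul]
          rw [← setIntegral_eq_integral_of_forall_compl_eq_zero hout]
          refine ext_inner_left ℝ fun e => ?_
          rw [← hvol hη e hhL, inner_zero_right, ← hinner (hmem hη (memLp_const e)) hhL,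
            Lp.toLp_coeFn]
          exact hh _ ⟨η, hη, e, rfl⟩
      rw [Lp.eq_zero_iff_ae_eq_zero]
      exact (ae_restrict_iff' hD.measurableSet).2 this
    · rintro a ⟨η, hη, e, rfl⟩
      simp_rw [hinner, hvol hη e (hf _), hvol hη e hf₀]
      exact tendsto_const_nhds.inner (hweak η hη)
    · rw [Lp.tendsto_Lp_iff_tendsto_eLpNorm'']
      refine tendsto_eLpNorm_zero_of_le_mul (B := B) (fun n x => ?_) hstrong
      simp only [Pi.sub_apply, ← smul_sub, norm_smul]
      gcongr
      exact hB x
  have hout : ∀ (ψ : E3 → ℝ), tsupport ψ ⊆ D → ∀ x, x ∉ D →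
      ψ x • (inner ℝ (p₀ x) (f₀ x) : ℝ) = 0 := fun ψ h3 x hx => by
    rw [image_eq_zero_of_notMem_tsupport fun hx' => hx (h3 hx'), zero_smul]
  rw [ae_restrict_iff' hD.measurableSet]
  refine hD.ae_eq_zero_of_integral_contDiff_smul_eq_zero
    (IntegrableOn.locallyIntegrableOn hint) fun ψ h1 h2 h3 => ?_
  rw [← setIntegral_eq_integral_of_forall_compl_eq_zero (hout ψ h3)]
  exact key ψ ⟨h1, h2, h3⟩

/-! ### Closedness and cut-off defining functions of the surface -/

section Surface

/-- A point of `closure M` is at distance zero from `M`, so it is its own nearest point in `M`. -/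
theorem HasUniformTubularNeighborhood.isClosed {M : Set E3}
    (hM : HasUniformTubularNeighborhood M) : IsClosed M := by
  obtain ⟨δ, hδ, h⟩ := hM
  refine isClosed_of_closure_subset fun x hx => ?_
  obtain ⟨s, ⟨hs, hxs⟩, -⟩ := h x (Metric.closure_subset_thickening hδ M hx)
  have hd : dist x s = 0 := by
    rw [hxs]; exact (Metric.mem_closure_iff_infDist_zero ⟨s, hs⟩).1 hx
  rwa [dist_eq_zero.1 hd]

theorem IsLocalDefiningFunction.of_mem {M U : Set E3} {s y : E3} {γ : E3 → ℝ}
    (h : IsLocalDefiningFunction M s U γ) (hyM : y ∈ M) (hyU : y ∈ U) :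
    IsLocalDefiningFunction M y U γ :=
  ⟨hyM, h.isOpen, hyU, h.contDiffOn, h.regular, h.zeroSet⟩

/-- A local defining function agrees near its base point with a compactly supported `C²` function
on the whole space that vanishes on all of `M`. -/
theorem IsLocalDefiningFunction.exists_cutoff {M U : Set E3} {s : E3} {γ : E3 → ℝ}
    (h : IsLocalDefiningFunction M s U γ) :
    ∃ (r : ℝ) (f : E3 → ℝ), 0 < r ∧ Metric.ball s r ⊆ U ∧ ContDiff ℝ 2 f ∧ HasCompactSupport f ∧
      (∀ y ∈ M, f y = 0) ∧ EqOn f γ (Metric.ball s r) := by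
  obtain ⟨R, hR, hRU⟩ := Metric.isOpen_iff.1 h.isOpen s h.mem
  let χ : ContDiffBump s := ⟨R / 3, R / 2, by positivity, by linarith⟩
  have hχU : tsupport χ ⊆ U := by
    rw [χ.tsupport_eq]
    exact (Metric.closedBall_subset_ball (by change R / 2 < R; linarith)).trans hRU
  refine ⟨R / 3, fun y => χ y * γ y, by positivity,
    (Metric.ball_subset_ball (by linarith)).trans hRU, ?_, χ.hasCompactSupport.mul_right, ?_, ?_⟩
  · rw [contDiff_iff_contDiffAt]
    intro y
    by_cases hy : y ∈ tsupport χ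
    · exact χ.contDiffAt.mul (h.contDiffOn.contDiffAt (h.isOpen.mem_nhds (hχU hy)))
    · refine (contDiffAt_const (c := (0 : ℝ))).congr_of_eventuallyEq ?_
      filter_upwards [notMem_tsupport_iff_eventuallyEq.1 hy] with z hz
      simp [hz]
  · intro y hy
    by_cases hyU : y ∈ U
    · have : y ∈ {x | x ∈ U ∧ γ x = 0} := h.zeroSet ▸ ⟨hy, hyU⟩
      simp [this.2]
    · simp [image_eq_zero_of_notMem_tsupport fun hy' => hyU (hχU hy')]
  · intro y hy
    simp [χ.one_of_mem_closedBall (Metric.ball_subset_closedBall hy)]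

end Surface

/-! ### Square integrable fields on the probability space -/

section Probability

variable {Ω : Type*} [MeasurableSpace Ω]

theorem memLp_integral_prod_right {P : Measure Ω} [IsProbabilityMeasure P] {μ : Measure E3}
    [SFinite μ] {h : E3 × Ω → E3} (hh : MemLp h 2 (μ.prod P)) :
    MemLp (fun x => ∫ ω, h (x, ω) ∂P) 2 μ := by
  refine ⟨hh.1.integral_prod_right', ?_⟩
  rw [eLpNorm_lt_top_iff_lintegral_rpow_enorm_lt_top (by norm_num) (by norm_num)]
  have h2 := (eLpNorm_lt_top_iff_lintegral_rpow_enorm_lt_top (p := 2) (by norm_num)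
    (by norm_num)).1 hh.2
  rw [lintegral_prod _ (hh.1.enorm.pow_const _)] at h2
  refine lt_of_le_of_lt (lintegral_mono_ae ?_) h2
  filter_upwards [hh.1.prodMk_left] with x hx
  have h1 : ‖∫ ω, h (x, ω) ∂P‖ₑ ≤ eLpNorm (fun ω => h (x, ω)) 2 P := by
    refine (enorm_integral_le_lintegral_enorm _).trans ?_
    rw [← eLpNorm_one_eq_lintegral_enorm]
    exact eLpNorm_le_eLpNorm_of_exponent_le (by norm_num) hx
  refine (ENNReal.rpow_le_rpow h1 (by norm_num)).trans (le_of_eq ?_)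
  rw [eLpNorm_eq_lintegral_rpow_enorm_toReal (by norm_num) (by norm_num), ← ENNReal.rpow_mul]
  simp

variable [MetricSpace Ω] [CompactSpace Ω] [OpensMeasurableSpace Ω]

theorem continuousMap_memLp (P : Measure Ω) [IsFiniteMeasure P] (b : C(Ω, ℝ)) : MemLp b 2 P :=
  MemLp.of_bound b.continuous.aestronglyMeasurable ‖b‖ (Eventually.of_forall b.norm_coe_le_norm)

/-- Continuous functions need not be dense in `L²(P)`, as the `σ`-algebra may be strictly larger than
the Borel one. Orthogonality to them still forces `h = 0` when `h` is itself an `L²` limit of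
continuous functions. -/
theorem ae_eq_zero_of_dense_integral_mul_eq_zero {P : Measure Ω} [IsProbabilityMeasure P]
    {h : Ω → ℝ} (hh : MemLp h 2 P) {A : Set C(Ω, ℝ)} (hA : Dense A)
    (hAz : ∀ b ∈ A, ∫ ω, b ω * h ω ∂P = 0) {a : ℕ → C(Ω, ℝ)}
    (ha : Tendsto (fun n => eLpNorm (fun ω => a n ω - h ω) 2 P) atTop (𝓝 0)) : h =ᵐ[P] 0 := by
  have hinner : ∀ {q r : Ω → ℝ} (hq : MemLp q 2 P) (hr : MemLp r 2 P),
      (inner ℝ (hq.toLp q) (hr.toLp r) : ℝ) = ∫ ω, q ω * r ω ∂P := by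
    intro q r hq hr
    rw [L2.inner_def]
    refine integral_congr_ae ?_
    filter_upwards [hq.coeFn_toLp, hr.coeFn_toLp] with x h1 h2
    rw [h1, h2]
    simp [mul_comm]
  have hint : Integrable h P := hh.integrable (by norm_num)
  have hbi : ∀ b : C(Ω, ℝ), Integrable (fun ω => b ω * h ω) P := fun b =>
    hint.bdd_mul b.continuous.aestronglyMeasurable (Eventually.of_forall b.norm_coe_le_norm)
  have hall : ∀ b : C(Ω, ℝ), ∫ ω, b ω * h ω ∂P = 0 := by
    have hcont : Continuous fun b : C(Ω, ℝ) => ∫ ω, b ω * h ω ∂P := by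
      refine continuous_iff_continuousAt.2 fun b => tendsto_iff_norm_sub_tendsto_zero.2 ?_
      have h0 : Tendsto (fun b' : C(Ω, ℝ) => ‖b' - b‖ * ∫ ω, ‖h ω‖ ∂P) (𝓝 b) (𝓝 0) := by
        simpa using (tendsto_iff_norm_sub_tendsto_zero.1
          (tendsto_id (x := 𝓝 b))).mul_const (∫ ω, ‖h ω‖ ∂P)
      refine squeeze_zero (fun _ => norm_nonneg _) (fun b' => ?_) h0
      rw [← integral_sub (hbi b') (hbi b), ← integral_const_mul]
      refine norm_integral_le_of_norm_le (hint.norm.const_mul _) (Eventually.of_forall fun ω => ?_)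
      rw [← sub_mul, norm_mul]
      gcongr
      exact (b' - b).norm_coe_le_norm ω
    exact fun b => congrFun (hcont.ext_on hA continuous_const hAz) b
  have hlim : Tendsto (fun n => (continuousMap_memLp P (a n)).toLp (a n)) atTop
      (𝓝 (hh.toLp h)) := (Lp.tendsto_Lp_iff_tendsto_eLpNorm'' _ _ _ _).2 ha
  have h1 := hlim.inner (tendsto_const_nhds (x := hh.toLp h)) (𝕜 := ℝ)
  simp_rw [hinner (continuousMap_memLp P (a _)) hh, hall] at h1
  have h2 : hh.toLp h = 0 := inner_self_eq_zero.1 (tendsto_nhds_unique h1 tendsto_const_nhds)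
  have h3 := hh.coeFn_toLp
  rw [h2] at h3
  exact h3.symm.trans (Lp.coeFn_zero _ _ _)

end Probability

/-! ### Projection of potential fields -/

section Potential

theorem HasC1Gradient.clm_comp {Ω : Type*} [MetricSpace Ω] {T : E3 → Ω → Ω} {v : Ω → E3} {G : Ω → Mat3}
    (h : HasC1Gradient T v G) (π : E3 →L[ℝ] E3) :
    HasC1Gradient T (fun ω => π (v ω)) fun ω => WithLp.toLp 2 fun i => π (G ω i) := by
  refine ⟨π.continuous.comp h.1, ?_, fun ω i => ?_⟩
  · exact (PiLp.continuous_toLp 2 _).comp (continuous_pi fun i =>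
      π.continuous.comp ((PiLp.proj (𝕜 := ℝ) 2 (fun _ : Fin 3 => E3) i).continuous.comp h.2.1))
  · have := (π.continuous.tendsto _).comp (h.2.2 ω i)
    refine this.congr fun δ => ?_
    simp [map_sub]

/-- A potential field with rows in the kernel of `L` is a limit of gradients of functions with values
in this kernel: the orthogonal projection onto the kernel maps the approximating functions to such
functions, commutes with the stochastic gradient, is a contraction and fixes the limit. -/
theorem MemL2Pot.of_ae_mem_ker {Ω : Type*} [MetricSpace Ω] [MeasurableSpace Ω] {P : Measure Ω} {T : E3 → Ω → Ω} {V W : Set E3} {F : Ω → Mat3}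
    (h : MemL2Pot P T W F) (L : E3 →L[ℝ] ℝ) (hF : ∀ i, ∀ᵐ ω ∂P, L (F ω i) = 0)
    (hV : ∀ y, L y = 0 → y ∈ V) : MemL2Pot P T V F := by
  obtain ⟨hmem, v, G, hvG, hlim⟩ := h
  set Kr : Submodule ℝ E3 := LinearMap.ker (L : E3 →ₗ[ℝ] ℝ) with hKr
  set π : E3 →L[ℝ] E3 := Kr.starProjection with hπ
  refine ⟨hmem, fun n ω => π (v n ω), fun n ω => WithLp.toLp 2 fun i => π (G n ω i),
    fun n => ⟨(hvG n).1.clm_comp π, fun ω => hV _ ?_⟩, ?_⟩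
  · exact Kr.starProjection_apply_mem (v n ω)
  · refine tendsto_of_tendsto_of_tendsto_of_le_of_le tendsto_const_nhds hlim (fun n => zero_le)
      fun n => eLpNorm_mono_ae ?_
    filter_upwards [ae_all_iff.2 hF] with ω hω
    have hfix : ∀ i, π (F ω i) = F ω i := fun i =>
      Submodule.starProjection_eq_self_iff.2 (show F ω i ∈ Kr from hω i)
    rw [PiLp.norm_eq_of_L2, PiLp.norm_eq_of_L2]
    refine Real.sqrt_le_sqrt (Finset.sum_le_sum fun i _ => ?_)
    have e : (WithLp.toLp 2 (fun i => π (G n ω i)) - F ω : Mat3) i = π ((G n ω - F ω) i) := by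
      simp [map_sub, hfix]
    rw [e]
    gcongr
    exact (π.le_opNorm _).trans (mul_le_of_le_one_left (norm_nonneg _) Kr.starProjection_norm_le)

end Potential

/-! ### Weak two-scale convergence and normal components -/

section Limit

/-- This is where `C²` regularity enters: the gradient of `f` is Lipschitz. -/
theorem tendsto_eLpNorm_gradient_comp_sub {μ : Measure E3} {f : E3 → ℝ} (hf : ContDiff ℝ 2 f)
    (hfc : HasCompactSupport f) {w : ℕ → E3 → E3} {w₀ : E3 → E3}
    (hw : Tendsto (fun n => eLpNorm (fun x => w n x - w₀ x) 2 μ) atTop (𝓝 0)) :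
    Tendsto (fun n => eLpNorm (fun x => gradient f (w n x) - gradient f (w₀ x)) 2 μ) atTop
      (𝓝 0) := by
  obtain ⟨K, hK⟩ := (hf.fderiv_right (m := 1) (by norm_num)).lipschitzWith_of_hasCompactSupport
    (hfc.fderiv (𝕜 := ℝ)) one_ne_zero
  refine tendsto_eLpNorm_zero_of_le_mul (B := K) (fun n x => ?_) hw
  rw [gradient, gradient, ← map_sub, LinearIsometryEquiv.norm_map]
  simpa [dist_eq_norm] using hK.dist_le_mul (w n x) (w₀ x)

theorem inner_gradient_eq_fderiv (f : E3 → ℝ) (y v : E3) :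
    (inner ℝ (gradient f y) v : ℝ) = fderiv ℝ f y v := by
  simp [gradient]

theorem memLp_gradient_comp {D : Set E3} (hDb : Bornology.IsBounded D) {f : E3 → ℝ}
    (hf : ContDiff ℝ 1 f) (hfc : HasCompactSupport f) {w : E3 → E3}
    (hw : AEStronglyMeasurable w (volume.restrict D)) :
    MemLp (fun x => gradient f (w x)) 2 (volume.restrict D) := by
  have : IsFiniteMeasure (volume.restrict D) := ⟨by simpa using hDb.measure_lt_top⟩
  have hdf := hf.continuous_fderiv one_ne_zero
  obtain ⟨B, hB⟩ := (hfc.fderiv (𝕜 := ℝ)).exists_bound_of_continuous hdf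
  refine MemLp.of_bound (((InnerProductSpace.toDual ℝ E3).symm.continuous.comp
    hdf).comp_aestronglyMeasurable hw) B (Eventually.of_forall fun x => ?_)
  rw [gradient, LinearIsometryEquiv.norm_map]
  exact hB _

variable {Ω : Type*} [MetricSpace Ω] [CompactSpace Ω] [MeasurableSpace Ω] [OpensMeasurableSpace Ω]
  {P : Measure Ω} [IsProbabilityMeasure P]

theorem memLp_row {α : Type*} [MeasurableSpace α] {μ : Measure α} {G : α → Mat3}
    (hG : MemLp G 2 μ) (i : Fin 3) : MemLp (fun x => G x i) 2 μ :=
  hG.continuousLinearMap_comp (PiLp.proj (𝕜 := ℝ) 2 (fun _ : Fin 3 => E3) i)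

/-- If the `i`-th rows of a weakly two-scale convergent sequence are orthogonal to a strongly
convergent sequence `p n → p₀`, then so are the averages `∫ b(ω) v₀(x, ω)ᵢ dP(ω)` of the limit to
`p₀`, for every oscillation profile `b`. The oscillating factor is absorbed in the weakly convergent
sequence `x ↦ b(T_{x/ε} ω₀) vₑ(x)ᵢ`. -/
theorem WeakTwoScaleConverges.ae_inner_integral_eq_zero {D : Set E3} (hD : IsOpen D)
    (hDb : Bornology.IsBounded D) {T : E3 → Ω → Ω}
    (hT : Continuous fun p : E3 × Ω => T p.1 p.2) {ω₀ : Ω} {S : Set ℝ} {v : ℝ → E3 → Mat3}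
    {v₀ : E3 → Ω → Mat3} (hv : WeakTwoScaleConverges D P T ω₀ S v v₀) {ε : ℕ → ℝ}
    (hεS : ∀ n, ε n ∈ S) (hε : Tendsto ε atTop (𝓝 0)) {p : ℕ → E3 → E3} {p₀ : E3 → E3}
    (hp : ∀ n, MemLp (p n) 2 (volume.restrict D)) (hp₀ : MemLp p₀ 2 (volume.restrict D))
    (hpp : Tendsto (fun n => eLpNorm (fun x => p n x - p₀ x) 2 (volume.restrict D)) atTop (𝓝 0))
    (i : Fin 3) (horth : ∀ n, ∀ᵐ x ∂volume.restrict D, inner ℝ (p n x) (v (ε n) x i) = 0)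
    (b : C(Ω, ℝ)) :
    ∀ᵐ x ∂volume.restrict D, inner ℝ (p₀ x) (∫ ω, b ω • v₀ x ω i ∂P) = 0 := by
  have : IsFiniteMeasure (volume.restrict D) := ⟨by simpa using hDb.measure_lt_top⟩
  obtain ⟨hvm, hv₀, ⟨C, hC⟩, hw⟩ := hv
  have hεS' : Tendsto ε atTop (𝓝[S] 0) :=
    tendsto_nhdsWithin_iff.2 ⟨hε, Eventually.of_forall hεS⟩
  set β : ℕ → E3 → ℝ := fun n x => b (T ((ε n)⁻¹ • x) ω₀) with hβ
  have hβc : ∀ n, Continuous (β n) := fun n =>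
    b.continuous.comp (hT.comp ((continuous_const_smul _).prodMk continuous_const))
  have hβb : ∀ n x, ‖β n x‖ ≤ ‖b‖ := fun n x => b.norm_coe_le_norm _
  have hbv₀ : MemLp (fun q : E3 × Ω => b q.2 • v₀ q.1 q.2) 2 ((volume.restrict D).prod P) :=
    hv₀.of_le_mul (c := ‖b‖)
      ((b.continuous.stronglyMeasurable.comp_measurable measurable_snd).aestronglyMeasurable.smul
        hv₀.1) (Eventually.of_forall fun q => by
          rw [norm_smul]; gcongr; exact b.norm_coe_le_norm _)
  have hbv₀i : MemLp (fun q : E3 × Ω => b q.2 • v₀ q.1 q.2 i) 2 ((volume.restrict D).prod P) :=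
    memLp_row hbv₀ i
  have hbint : Integrable (fun q : E3 × Ω => b q.2 • v₀ q.1 q.2) ((volume.restrict D).prod P) :=
    hbv₀.integrable (by norm_num)
  set pr : Mat3 →L[ℝ] E3 := PiLp.proj (𝕜 := ℝ) 2 (fun _ : Fin 3 => E3) i with hpr
  refine ae_inner_eq_zero_of_weak_strong hD hDb (f := fun n x => β n x • v (ε n) x i)
    (f₀ := fun x => ∫ ω, b ω • v₀ x ω i ∂P) (p := p) (C := ‖b‖ * C)
    (fun n => memLp_smul_of_bound (hβc n) (hβb n) (memLp_row (hvm _ (hεS n)) i))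
    (memLp_integral_prod_right hbv₀i) hp hp₀ ?_ ?_ hpp ?_
  · filter_upwards [hεS'.eventually hC] with n hn
    rw [ENNReal.ofReal_mul (norm_nonneg _)]
    refine (eLpNorm_le_mul_eLpNorm_of_ae_le_mul (g := v (ε n)) (c := ‖b‖)
      (Eventually.of_forall fun x => ?_) 2).trans (by gcongr)
    rw [norm_smul]
    exact mul_le_mul (hβb n x) (PiLp.norm_apply_le _ _) (norm_nonneg _) (norm_nonneg _)
  · intro ψ hψ
    obtain ⟨B, -, hB⟩ := hψ.exists_bound
    have h1 := (pr.continuous.tendsto _).comp ((hw ψ hψ b).comp hεS')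
    have hR : pr (∫ x in D, ∫ ω', (ψ x * b ω') • v₀ x ω' ∂P) =
        ∫ x in D, ψ x • ∫ ω, b ω • v₀ x ω i ∂P := by
      have hin : ∀ x, ∫ ω', (ψ x * b ω') • v₀ x ω' ∂P = ψ x • ∫ ω', b ω' • v₀ x ω' ∂P :=
        fun x => by rw [← integral_smul]; simp_rw [smul_smul]
      have hI : Integrable (fun x => ψ x • ∫ ω', b ω' • v₀ x ω' ∂P) (volume.restrict D) :=
        hbint.integral_prod_left.bdd_smul _ hψ.1.continuous.aestronglyMeasurable
          (Eventually.of_forall hB)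
      simp_rw [hin]
      rw [← pr.integral_comp_comm hI]
      refine integral_congr_ae ?_
      filter_upwards [hbint.prod_right_ae] with x hx
      rw [map_smul, ← pr.integral_comp_comm hx]
      rfl
    rw [hR] at h1
    refine h1.congr fun n => ?_
    have hI : Integrable (fun x => (ψ x * b (T ((ε n)⁻¹ • x) ω₀)) • v (ε n) x)
        (volume.restrict D) := by
      have := (memLp_smul_of_bound hψ.1.continuous hB
        (memLp_smul_of_bound (hβc n) (hβb n) (hvm _ (hεS n)))).integrable (by norm_num)
      simpa [smul_smul] using this
    change pr (∫ x in D, (ψ x * b (T ((ε n)⁻¹ • x) ω₀)) • v (ε n) x) = _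
    rw [← pr.integral_comp_comm hI]
    refine integral_congr_ae (Eventually.of_forall fun x => ?_)
    simp [hpr, hβ, smul_smul]
  · intro n
    filter_upwards [horth n] with x hx
    rw [real_inner_smul_right, hx, mul_zero]

/-- For a potential field `F`, the function `L (F · i)` is an `L²` limit of continuous functions, so
orthogonality to a dense set of continuous functions makes it vanish. -/
theorem MemL2Pot.ae_clm_eq_zero {T : E3 → Ω → Ω} {V : Set E3} {F : Ω → Mat3}
    (hF : MemL2Pot P T V F) (L : E3 →L[ℝ] ℝ) (i : Fin 3) {A : Set C(Ω, ℝ)} (hA : Dense A)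
    (hAz : ∀ b ∈ A, L (∫ ω, b ω • F ω i ∂P) = 0) : ∀ᵐ ω ∂P, L (F ω i) = 0 := by
  obtain ⟨hmem, v, G, hvG, hlim⟩ := hF
  have hi : MemLp (fun ω => F ω i) 2 P := memLp_row hmem i
  refine ae_eq_zero_of_dense_integral_mul_eq_zero (hi.continuousLinearMap_comp L) hA
    (fun b hb => ?_) (a := fun n => ⟨fun ω => L (G n ω i), L.continuous.comp
      ((PiLp.proj (𝕜 := ℝ) 2 (fun _ : Fin 3 => E3) i).continuous.comp (hvG n).1.2.1)⟩) ?_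
  · have hI : Integrable (fun ω => b ω • F ω i) P :=
      (hi.integrable (by norm_num)).bdd_smul _ b.continuous.aestronglyMeasurable
        (Eventually.of_forall b.norm_coe_le_norm)
    rw [← hAz b hb, ← L.integral_comp_comm hI]
    simp
  · refine tendsto_eLpNorm_zero_of_le_mul (B := ‖L‖) (fun n ω => ?_) hlim
    change ‖L (G n ω i) - L (F ω i)‖ ≤ _
    rw [← map_sub]
    refine (L.le_opNorm _).trans ?_
    gcongr
    exact PiLp.norm_apply_le (G n ω - F ω) i

end Limit

theorem ae_mem_of_tendsto_eLpNorm {μ : Measure E3} {M : Set E3} (hM : IsClosed M)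
    {w : ℕ → E3 → E3} {w₀ : E3 → E3} (hw : ∀ n, AEStronglyMeasurable (w n) μ)
    (hw₀ : AEStronglyMeasurable w₀ μ)
    (hlim : Tendsto (fun n => eLpNorm (fun x => w n x - w₀ x) 2 μ) atTop (𝓝 0))
    (hwM : ∀ n, ∀ᵐ x ∂μ, w n x ∈ M) : ∀ᵐ x ∂μ, w₀ x ∈ M := by
  obtain ⟨k, -, hk⟩ := (tendstoInMeasure_of_tendsto_eLpNorm (by norm_num) hw hw₀
    hlim).exists_seq_tendsto_ae
  filter_upwards [hk, ae_all_iff.2 hwM] with x hx hxM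
  exact hM.mem_of_tendsto hx (Eventually.of_forall fun n => hxM _)

end StochHom

open StochHom in
theorem proposition3p14
    {Ω : Type*} [MetricSpace Ω] [CompactSpace Ω] [MeasurableSpace Ω] [OpensMeasurableSpace Ω]
    (P : MeasureTheory.Measure Ω) [MeasureTheory.IsProbabilityMeasure P]
    (T : StochHom.E3 → Ω → Ω) (hT : StochHom.IsErgodicDynamicalSystem P T)
    (ω₀ : Ω) (hω₀ : StochHom.IsTypicalTrajectory P T ω₀)
    (D : Set StochHom.E3) (hDopen : IsOpen D) (hDbdd : Bornology.IsBounded D)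
    (M : Set StochHom.E3) (hM : StochHom.IsC2Hypersurface M)
    (hMor : StochHom.IsOrientableSurface M)
    (hMtub : StochHom.HasUniformTubularNeighborhood M)
    (S : Set ℝ) (hSpos : ∀ ε ∈ S, 0 < ε) (hS0 : (0 : ℝ) ∈ closure S)
    (u : ℝ → StochHom.E3 → StochHom.E3) (gradu : ℝ → StochHom.E3 → StochHom.Mat3)
    (hu : ∀ ε ∈ S, StochHom.MemH1Into D M (u ε))
    (hgradu : ∀ ε ∈ S, StochHom.HasH1Gradient D (u ε) (gradu ε))
    (u₀ : StochHom.E3 → StochHom.E3) (gradu₀ : StochHom.E3 → StochHom.Mat3)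
    (hu₀ : StochHom.HasH1Gradient D u₀ gradu₀)
    (Ξ : StochHom.E3 → Ω → StochHom.Mat3)
    (hΞ : StochHom.MemL2L2Pot D P T (fun _ => Set.univ) Ξ)
    (hconv : Filter.Tendsto
      (fun ε => MeasureTheory.eLpNorm (fun x => u ε x - u₀ x) 2
        (MeasureTheory.volume.restrict D)) (nhdsWithin 0 S) (nhds 0))
    (hgrad : StochHom.WeakTwoScaleConverges D P T ω₀ S gradu
      (fun x ω => gradu₀ x + Ξ x ω)) :
    StochHom.MemH1Into D M u₀ ∧
      StochHom.MemL2L2Pot D P T (fun x => StochHom.tangentSpaceAt M (u₀ x)) Ξ := by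
  obtain ⟨ε, hεS, hε⟩ := mem_closure_iff_seq_limit.1 hS0
  have hε' : Tendsto ε atTop (𝓝[S] 0) :=
    tendsto_nhdsWithin_iff.2 ⟨hε, Eventually.of_forall hεS⟩
  have hlim := hconv.comp hε'
  have hu₀M : ∀ᵐ x ∂volume.restrict D, u₀ x ∈ M :=
    ae_mem_of_tendsto_eLpNorm hMtub.isClosed (fun n => (hgradu _ (hεS n)).1.1) hu₀.1.1 hlim
      fun n => (hu _ (hεS n)).2
  refine ⟨⟨⟨gradu₀, hu₀⟩, hu₀M⟩, hΞ.1, ?_⟩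
  have : SecondCountableTopology Ω := UniformSpace.secondCountable_of_separable Ω
  obtain ⟨A, hAc, hAd⟩ := TopologicalSpace.exists_countable_dense C(Ω, ℝ)
  -- `Ξ` alone is tangential, since both `∇u₀ + Ξ` (on average against each `b`) and `∇u₀` are.
  have main : ∀ f : E3 → ℝ, ContDiff ℝ 2 f → HasCompactSupport f → (∀ y ∈ M, f y = 0) →
      ∀ᵐ x ∂volume.restrict D, ∀ i, ∀ᵐ ω ∂P, fderiv ℝ f (u₀ x) (Ξ x ω i) = 0 := by
    intro f hf hfc hfM
    have hf1 : ContDiff ℝ 1 f := hf.of_le (by norm_num)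
    have hb : ∀ i, ∀ b ∈ A, ∀ᵐ x ∂volume.restrict D,
        inner ℝ (gradient f (u₀ x)) (∫ ω, b ω • (gradu₀ x + Ξ x ω) i ∂P) = 0 := by
      intro i b _
      refine hgrad.ae_inner_integral_eq_zero hDopen hDbdd hT.continuous hεS hε
        (p := fun n x => gradient f (u (ε n) x))
        (fun n => memLp_gradient_comp hDbdd hf1 hfc (hgradu _ (hεS n)).1.1)
        (memLp_gradient_comp hDbdd hf1 hfc hu₀.1.1)
        (tendsto_eLpNorm_gradient_comp_sub hf hfc hlim) i (fun n => ?_) b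
      filter_upwards [(hgradu _ (hεS n)).ae_fderiv_eq_zero hDopen hDbdd hf1 hfc
        ((hu _ (hεS n)).2.mono fun x hx => hfM _ hx)] with x hx
      rw [inner_gradient_eq_fderiv, hx i]
    have hb' := ae_all_iff.2 fun i => (ae_ball_iff hAc).2 (hb i)
    filter_upwards [hb', hΞ.2, hu₀.ae_fderiv_eq_zero hDopen hDbdd hf1 hfc
      (hu₀M.mono fun x hx => hfM _ hx)] with x hx hpot hx₀ i
    refine hpot.ae_clm_eq_zero (fderiv ℝ f (u₀ x)) i hAd fun b hbA => ?_
    have h1 := hx i b hbA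
    have hbm := b.continuous.aestronglyMeasurable (μ := P)
    have hI : ∀ {F : Ω → E3}, Integrable F P → Integrable (fun ω => b ω • F ω) P := fun hF =>
      hF.bdd_smul _ hbm (Eventually.of_forall b.norm_coe_le_norm)
    have hΞi : Integrable (fun ω => Ξ x ω i) P := (memLp_row hpot.1 i).integrable (by norm_num)
    simp_rw [PiLp.add_apply, smul_add] at h1
    rw [integral_add (hI (integrable_const _)) (hI hΞi), inner_gradient_eq_fderiv, map_add,
      integral_smul_const, map_smul, hx₀ i, smul_zero, zero_add] at h1
    exact h1
  -- Countably many charts cover `M`, so the exceptional null sets can be collected.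
  choose! U γ hγ using hM
  choose! r f hr hrU hf hfc hfM hfγ using fun s hs => (hγ s hs).exists_cutoff
  obtain ⟨t, htM, htc, hMt⟩ := TopologicalSpace.countable_cover_nhdsWithin
    (f := fun s => Metric.ball s (r s)) fun s hs =>
      mem_nhdsWithin_of_mem_nhds (Metric.ball_mem_nhds s (hr s hs))
  filter_upwards [hu₀M, hΞ.2, (ae_ball_iff htc).2 fun s hs =>
    main (f s) (hf s (htM hs)) (hfc s (htM hs)) (hfM s (htM hs))] with x hxM hpot hx
  obtain ⟨s, hs, hxs⟩ := mem_iUnion₂.1 (hMt hxM)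
  refine hpot.of_ae_mem_ker (fderiv ℝ (f s) (u₀ x)) (hx s hs) fun y hy => ?_
  refine ⟨U s, γ s, (hγ s (htM hs)).of_mem hxM (hrU s (htM hs) hxs), ?_⟩
  rwa [← ((hfγ s (htM hs)).eventuallyEq_of_mem (Metric.isOpen_ball.mem_nhds hxs)).fderiv_eq]
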